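/- Conventions. Fix a physical dimension $d$. A tensor $A$ of bond dimension $D$ is a family of matrices $A^{ij}\in M_D(\mathbb C)$, $1\le i,j\le d$. With periodic boundary conditions it generates the operators $$U_N=\sum_{i,j}\operatorname{Tr}\bigl(A^{i_1j_1}\cdots A^{i_Nj_N}\bigr)\,|i_1\dots i_N\rangle\langle j_1\dots j_N| \quad\text{on } (\mathbb C^d)^{\otimes N}.$$ Write $\sum_l \overline{A^{li}}\otimes A^{lk}=\sum_{\alpha=0}^{d^2-1}(\sigma_\alpha)_{ik}\,S_\alpha$ for a basis $\{\sigma_\alpha\}$ of $M_d(\mathbb C)$, and let $\mathcal A=\operatorname{span}\{S_\alpha\}\subseteq \operatorname{End}(\mathbb C^D\otimes\mathbb C^D)$ (this span does not depend on the basis). The tensor $A$ is called semi-simple if, up to a similarity transformation of $\mathbb C^D\otimes\mathbb C^D$, $\mathcal A$ is block diagonal with irreducible blocks; that is, $\mathbb C^D\otimes\mathbb C^D$ is a direct sum of $\mathcal A$-invariant subspaces none of which has a nontrivial $\mathcal A$-invariant subspace. A family of operators $(U_N)_{N\ge1}$, $U_N$ acting on $(\mathbb C^d)^{\otimes N}$,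 is a semi-simple matrix-product unitary (MPU) with periodic boundary conditions if $U_N$ is unitary for all $N>1$ and, for some $D$ and some semi-simple tensor $A$ of bond dimension $D$, the operators $U_N$, $N>1$, are generated by $A$ with periodic boundary conditions. Blocking $q$ sites means regarding $U_{qN}$ as an operator on $N$ sites of dimension $d^q$. Statement. (1) Let $(U_N)$ be a semi-simple MPU with periodic boundary conditions. Then, after blocking a finite number $q\ge 1$ of sites (independent of $N$), there are $\theta\in\mathbb R$ and a unitary $V$ on one blocked site, both independent of $N$, such that $$U_{qN}=e^{i\theta N}\,V^{\otimes N}\qquad\text{for all } N\ge 1 .$$ (2) Consequently, no nontrivial quantum cellular automaton is a semi-simple MPU with periodic boundary conditions. Precisely, let $(U_N)_{N\ge 1}$ be operators on rings of $N$ sites, unitary for $N>1$, for which there is an $R$ independent of $N$ such that, for every $N>1$, every site $x$ and every operator $O$ supported on $x$, the operator $U_N^\dagger O\,U_N$ is supported on the sites at distance at most $R$ from $x$. If $(U_N)$ is not of the product form in (1) for any $q\ge1$, then $(U_N)$ is not a semi-simple MPU with periodic boundary conditions. -/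

import Mathlib

open scoped Kronecker

noncomputable section

namespace MPU

/-! Indices: `p` labels a basis of the one-site physical space, so `Fin N → p` labels the product
basis of `N` sites. -/

/-- A bulk tensor with physical index set `p` and bond dimension `D`: the matrices `A i j`
(`i` output, `j` input). -/
abbrev Tensor (p : Type) (D : ℕ) : Type := p → p → Matrix (Fin D) (Fin D) ℂ

/-- A family of operators, one on `N` sites for each `N`. -/
abbrev OperatorFamily (p : Type) : Type :=
  (N : ℕ) → Matrix (Fin N → p) (Fin N → p) ℂ

/-- The product `A^{i₁ j₁} ⋯ A^{i_N j_N}` along a chain. -/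
def chain {p : Type} {D : ℕ} (A : Tensor p D) {N : ℕ} (i j : Fin N → p) :
    Matrix (Fin D) (Fin D) ℂ :=
  (List.ofFn fun k => A (i k) (j k)).prod

/-- The matrix-product operators with bulk tensor `A` and boundary condition `b`:
`⟨i| U_N |j⟩ = Tr (b A^{i₁ j₁} ⋯ A^{i_N j_N})`. Periodic boundary conditions are `b = 1`. -/
def mpo {p : Type} {D : ℕ} (A : Tensor p D) (b : Matrix (Fin D) (Fin D) ℂ) :
    OperatorFamily p :=
  fun _ => Matrix.of fun i j => Matrix.trace (b * chain A i j)

/-- All members of the family on more than one site are unitary. -/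
def IsUnitaryFamily {p : Type} [Fintype p] [DecidableEq p] (U : OperatorFamily p) : Prop :=
  ∀ N : ℕ, 1 < N → U N ∈ Matrix.unitaryGroup (Fin N → p) ℂ

/-- The tensor `A` with boundary condition `b` represents the family `U`. -/
def Represents {p : Type} {D : ℕ} (A : Tensor p D) (b : Matrix (Fin D) (Fin D) ℂ)
    (U : OperatorFamily p) : Prop :=
  ∀ N : ℕ, 1 < N → U N = mpo A b N

/-! ### Semi-simplicity -/

/-- The contraction of `A` with its complex conjugate over one physical leg, as in `U† U`: for
physical indices `i`, `k` it is the matrix `∑ l, conj (A^{l i}) ⊗ A^{l k}` on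
`ℂ^D ⊗ ℂ^D`. -/
def double {p : Type} [Fintype p] {D : ℕ} (A : Tensor p D) (i k : p) :
    Matrix (Fin D × Fin D) (Fin D × Fin D) ℂ :=
  ∑ l, (A l i).map (starRingEnd ℂ) ⊗ₖ A l k

/-- The span of the coefficients `S_α` of the doubled tensor in an operator basis `σ_α` of the
physical space (see `span_coefficients`: the span does not depend on the basis, so we use the
matrix units). -/
def opSpan {p : Type} [Fintype p] {D : ℕ} (A : Tensor p D) :
    Submodule ℂ (Matrix (Fin D × Fin D) (Fin D × Fin D) ℂ) :=
  Submodule.span ℂ (Set.range fun x : p × p => double A x.1 x.2)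

/-- If `∑ l, conj (A^{l i}) ⊗ A^{l k} = ∑ α, (σ_α)_{i k} S_α` with `σ` a basis of the
one-site operators, then the `S_α` span `opSpan A`. -/
theorem span_coefficients {p : Type} [Fintype p] {D : ℕ} (A : Tensor p D)
    {ι : Type} [Fintype ι] (σ : Module.Basis ι ℂ (Matrix p p ℂ))
    (S : ι → Matrix (Fin D × Fin D) (Fin D × Fin D) ℂ)
    (h : ∀ i k, double A i k = ∑ α, σ α i k • S α) :
    Submodule.span ℂ (Set.range S) = opSpan A := by
  classical
  apply le_antisymm
  · rw [Submodule.span_le]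
    rintro _ ⟨α, rfl⟩
    have key : S α = ∑ i, ∑ k, σ.repr (Matrix.single i k 1) α • double A i k := by
      have e : ∀ β, ∑ i, ∑ k, σ.repr (Matrix.single i k 1) α * σ β i k
          = if β = α then 1 else 0 := by
        intro β
        have h1 : σ β = ∑ i, ∑ k, σ β i k • Matrix.single i k (1 : ℂ) := by
          conv_lhs => rw [Matrix.matrix_eq_sum_single (σ β)]
          simp
        have h2 := congrArg (fun X => σ.repr X α) h1
        simp only [Module.Basis.repr_self, map_sum, map_smul, Finsupp.coe_finsetSum,
          Finset.sum_apply, Finsupp.smul_apply, smul_eq_mul] at h2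
        rw [Finsupp.single_apply] at h2
        rw [h2]
        simp [mul_comm]
      calc S α = ∑ β, (if β = α then (1 : ℂ) else 0) • S β := by simp
        _ = ∑ β, (∑ i, ∑ k, σ.repr (Matrix.single i k 1) α * σ β i k) • S β := by
            simp only [e]
        _ = _ := by
            simp only [h, Finset.sum_smul, Finset.smul_sum, mul_smul]
            rw [Finset.sum_comm]
            refine Finset.sum_congr rfl fun i _ => ?_
            rw [Finset.sum_comm]
    rw [SetLike.mem_coe, key]
    exact Submodule.sum_mem _ fun i _ => Submodule.sum_mem _ fun k _ =>
      Submodule.smul_mem _ _ (Submodule.subset_span ⟨(i, k), rfl⟩)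
  · unfold opSpan
    rw [Submodule.span_le]
    rintro _ ⟨⟨i, k⟩, rfl⟩
    simp only [SetLike.mem_coe, h]
    exact Submodule.sum_mem _ fun α _ =>
      Submodule.smul_mem _ _ (Submodule.subset_span ⟨α, rfl⟩)

/-- `M` is a common invariant subspace of the matrices in `𝒜`. -/
def IsInvariant {n : Type} [Fintype n] (𝒜 : Submodule ℂ (Matrix n n ℂ))
    (M : Submodule ℂ (n → ℂ)) : Prop :=
  ∀ S ∈ 𝒜, ∀ v ∈ M, S.mulVec v ∈ M

/-- `M` is a nonzero invariant subspace on which `𝒜` acts irreducibly: it has no common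
invariant subspaces other than `0` and `M`. -/
def IsIrreducibleBlock {n : Type} [Fintype n] (𝒜 : Submodule ℂ (Matrix n n ℂ))
    (M : Submodule ℂ (n → ℂ)) : Prop :=
  IsInvariant 𝒜 M ∧ M ≠ ⊥ ∧ ∀ M', M' ≤ M → IsInvariant 𝒜 M' → M' = ⊥ ∨ M' = M

/-- `ℂ^D ⊗ ℂ^D` is a direct sum of subspaces which are invariant under the span of the `S_α`
and on which it acts irreducibly, i.e. up to a similarity transformation of `ℂ^D ⊗ ℂ^D` the span
is block diagonal with irreducible blocks. -/
def IsSemisimple {p : Type} [Fintype p] {D : ℕ} (A : Tensor p D) : Prop :=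
  ∃ (m : ℕ) (M : Fin m → Submodule ℂ (Fin D × Fin D → ℂ)),
    DirectSum.IsInternal M ∧ ∀ a, IsIrreducibleBlock (opSpan A) (M a)

/-- `U` is a semi-simple matrix-product unitary with periodic boundary conditions. -/
def IsPeriodicSemisimpleMPU {p : Type} [Fintype p] [DecidableEq p]
    (U : OperatorFamily p) : Prop :=
  IsUnitaryFamily U ∧ ∃ (D : ℕ) (A : Tensor p D), Represents A 1 U ∧ IsSemisimple A

/-! ### Blocking and product unitaries -/

/-- Blocking `q` tensors together: physical dimension `d ^ q`, same bond dimension. -/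
def Tensor.block {p : Type} {D : ℕ} (q : ℕ) (A : Tensor p D) : Tensor (Fin q → p) D :=
  fun i j => chain A i j

/-- The configuration of `N * q` sites given by `N` consecutive blocks of `q` sites. -/
def unblock {p : Type} {q N : ℕ} (i : Fin N → Fin q → p) : Fin (N * q) → p :=
  fun s => i s.divNat s.modNat

/-- The family in which `q` neighbouring sites are regarded as one site. -/
def OperatorFamily.block {p : Type} (q : ℕ) (U : OperatorFamily p) :
    OperatorFamily (Fin q → p) :=
  fun N => Matrix.of fun i j => U (N * q) (unblock i) (unblock j)

/-- Blocking tensors and blocking operators agree. -/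
theorem mpo_block {p : Type} {D : ℕ} (q : ℕ) (A : Tensor p D)
    (b : Matrix (Fin D) (Fin D) ℂ) :
    mpo (Tensor.block q A) b = OperatorFamily.block q (mpo A b) := by
  funext N
  ext i j
  simp only [mpo, OperatorFamily.block, Matrix.of_apply, chain, Tensor.block]
  rw [List.ofFn_mul, List.prod_flatten, List.map_ofFn]
  congr 4
  funext k
  simp only [Function.comp_apply]
  congr 2
  funext l
  have h := finProdFinEquiv.symm_apply_apply (k, l)
  have hval : (⟨(k : ℕ) * q + l, by
      calc (k : ℕ) * q + l < (k + 1) * q := by rw [Nat.add_mul, one_mul]; omega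
        _ ≤ N * q := Nat.mul_le_mul_right _ k.isLt⟩ : Fin (N * q)) = finProdFinEquiv (k, l) := by
    apply Fin.ext
    simp [finProdFinEquiv, mul_comm, add_comm]
  have h1 : (finProdFinEquiv (k, l)).divNat = k := congrArg Prod.fst h
  have h2 : (finProdFinEquiv (k, l)).modNat = l := congrArg Prod.snd h
  simp only [unblock, hval, h1, h2]

/-- `V^{⊗ N}`. -/
def tensorPower {p : Type} (V : Matrix p p ℂ) : OperatorFamily p :=
  fun _ => Matrix.of fun i j => ∏ k, V (i k) (j k)

/-- `U_N = e^{i θ N} V^{⊗ N}` for all `N ≥ 1`, with `V` unitary and `θ`, `V` independent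
of `N`. -/
def IsProductUnitary {p : Type} [Fintype p] [DecidableEq p] (U : OperatorFamily p) : Prop :=
  ∃ (θ : ℝ) (V : Matrix p p ℂ), V ∈ Matrix.unitaryGroup p ℂ ∧
    ∀ N : ℕ, 1 ≤ N → U N = Complex.exp (Complex.I * θ * N) • tensorPower V N

/-! ### Quantum cellular automata -/

/-- The operator `O` on `N` sites is of the form `X ⊗ 1` with `X` acting on the sites in `Λ`. -/
def IsSupportedOn {p : Type} {N : ℕ} (Λ : Set (Fin N))
    (O : Matrix (Fin N → p) (Fin N → p) ℂ) : Prop :=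
  ∃ X : Matrix (Λ → p) (Λ → p) ℂ, ∀ i j : Fin N → p,
    ((∀ k ∉ Λ, i k = j k) → O i j = X (fun k => i k) (fun k => j k)) ∧
    ((∃ k ∉ Λ, i k ≠ j k) → O i j = 0)

/-- The sites of a ring of `N` sites at distance at most `R` from `x`. -/
def ringBall {N : ℕ} (R : ℕ) (x : Fin N) : Set (Fin N) :=
  {y | ∃ r ≤ R, ((x : ℕ) + r) % N = y ∨ ((y : ℕ) + r) % N = x}

/-- A family of one-dimensional quantum cellular automata: unitaries `U_N` on rings of `N` sites
such that, for some range `R` independent of `N`, `U_N† O U_N` is supported within distance `R`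
of `x` for each operator `O` supported on a single site `x`. -/
def IsQCA {p : Type} [Fintype p] [DecidableEq p] (U : OperatorFamily p) : Prop :=
  IsUnitaryFamily U ∧ ∃ R : ℕ, ∀ N : ℕ, 1 < N → ∀ (x : Fin N)
    (O : Matrix (Fin N → p) (Fin N → p) ℂ), IsSupportedOn {x} O →
      IsSupportedOn (ringBall R x) ((U N).conjTranspose * O * U N)

end MPU

end

/-! Traces of products of at least two doubled tensors are the entries of $U_N^\dagger U_N$, so
unitarity makes them products of Kronecker deltas (`trace_word`). In an algebra acting on a direct
sum of irreducible blocks, an element $F$ with $\operatorname{Tr}(FxFy)=0$ for all $x,y$ in the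
algebra vanishes (`eq_zero_of_trace_mul_eq_zero`). Hence words with equal traces in all contexts
coincide, and the doubled tensor is $\delta_{ik}E$ with $E^2=E$, $\operatorname{Tr}E=1$
(`exists_double_eq`). This forces $A^{lk}=V_{lk}w$ with $V$ unitary and $\bar w\otimes w=E$
(`exists_tensor_eq_smul`). Up to a phase $w$ is then a rank-one idempotent, so
$\operatorname{Tr}w^N=e^{i\theta N}$ (`exists_trace_pow_eq`) and $U_N=e^{i\theta N}V^{\otimes N}$
for $N>1$. Part (2) is the contrapositive of part (1). -/

namespace MPU

/-! ### Vanishing traces and irreducible blocks. -/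

open Polynomial in
/-- An endomorphism fixing a nonzero vector has a power, of exponent at least two, of nonzero
trace. -/
theorem exists_trace_pow_ne_zero {V : Type*} [AddCommGroup V] [Module ℂ V]
    [FiniteDimensional ℂ V] (f : Module.End ℂ V) {v : V} (hv : v ≠ 0) (hf : f v = v) :
    ∃ n : ℕ, LinearMap.trace ℂ V (f ^ (n + 2)) ≠ 0 := by
  by_contra! htr
  have hX : ∀ q : ℂ[X], LinearMap.trace ℂ V (aeval f (q * X ^ 2)) = 0 := by
    intro q
    induction q using Polynomial.induction_on' with
    | add p q hp hq => rw [add_mul, map_add, map_add, hp, hq, add_zero]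
    | monomial n a =>
      rw [← C_mul_X_pow_eq_monomial, mul_assoc, ← pow_add, map_mul, aeval_C, map_pow, aeval_X,
        ← Algebra.smul_def, map_smul, htr, smul_zero]
  have heig : f.HasEigenvector 1 v := by
    rw [Module.End.hasEigenvector_iff, Module.End.mem_eigenspace_iff]
    exact ⟨by simpa using hf, hv⟩
  have hm : minpoly ℂ f ≠ 0 := minpoly.ne_zero (Algebra.IsIntegral.isIntegral f)
  obtain ⟨g, hg, hdvd⟩ := exists_eq_pow_rootMultiplicity_mul_and_not_dvd _ hm 0
  set k := rootMultiplicity 0 (minpoly ℂ f)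
  rw [C_0, sub_zero] at hg hdvd
  -- By Bezout, $uX^{k+2}$ at `f` is the projection killing the nilpotent part. Exponent $k$ would
  -- suffice for idempotence; the extra $X^2$ leaves only powers $f^n$ with $n\ge2$ in its trace.
  have hcop : IsCoprime (X ^ (k + 2)) g :=
    IsCoprime.pow_left ((irreducible_X.coprime_iff_not_dvd).2 hdvd)
  obtain ⟨u, w, huw⟩ := hcop
  have hg1 : g.eval 1 = 0 := by
    have h := Module.End.aeval_apply_of_hasEigenvector (p := minpoly ℂ f) heig
    rw [minpoly.aeval, LinearMap.zero_apply, hg, eval_mul, eval_pow, eval_X, one_pow, one_mul]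
      at h
    exact (smul_eq_zero.1 h.symm).resolve_right hv
  have hone : (aeval f (u * X ^ (k + 2))) v = v := by
    rw [Module.End.aeval_apply_of_hasEigenvector heig, eq_sub_of_add_eq huw]
    simp [hg1]
  have hid : IsIdempotentElem (aeval f (u * X ^ (k + 2))) := by
    have : u * X ^ (k + 2) * (u * X ^ (k + 2)) =
        u * X ^ (k + 2) - u * w * X ^ 2 * (X ^ k * g) := by
      linear_combination (u * X ^ (k + 2)) * huw
    rw [IsIdempotentElem, ← map_mul, this, ← hg, map_sub, map_mul _ _ (minpoly ℂ f),
      minpoly.aeval, mul_zero, sub_zero]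
  have h0 := LinearMap.IsIdempotentElem.eq_zero_of_trace_eq_zero hid (by rw [pow_add, ← mul_assoc]; exact hX _)
  rw [h0] at hone
  exact hv (by simpa using hone.symm)

/-- An element of the algebra generated by a semi-simple span which generates a two-sided ideal
of vanishing traces is zero. -/
theorem eq_zero_of_trace_mul_eq_zero {n : Type} [Fintype n] [DecidableEq n]
    {𝒜 : Submodule ℂ (Matrix n n ℂ)} {m : ℕ} {M : Fin m → Submodule ℂ (n → ℂ)}
    (hM : DirectSum.IsInternal M) (hirr : ∀ a, IsIrreducibleBlock 𝒜 (M a))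
    {F : Matrix n n ℂ} (hF : F ∈ Algebra.adjoin ℂ (𝒜 : Set (Matrix n n ℂ)))
    (htr : ∀ x ∈ Algebra.adjoin ℂ (𝒜 : Set (Matrix n n ℂ)),
      ∀ y ∈ Algebra.adjoin ℂ (𝒜 : Set (Matrix n n ℂ)), (F * (x * F * y)).trace = 0) :
    F = 0 := by
  set B := Algebra.adjoin ℂ (𝒜 : Set (Matrix n n ℂ)) with hB
  have hker : ∀ a, M a ≤ LinearMap.ker (Matrix.toLin' F) := by
    intro a v hv
    obtain ⟨hinv, -, hmin⟩ := hirr a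
    have hinvB : ∀ y ∈ B, ∀ v ∈ M a, y.mulVec v ∈ M a := by
      intro y hy
      induction hy using Algebra.adjoin_induction with
      | mem x hx => exact hinv x hx
      | algebraMap r =>
        intro v hv
        rw [Algebra.algebraMap_eq_smul_one, Matrix.smul_mulVec, Matrix.one_mulVec]
        exact (M a).smul_mem _ hv
      | add x y _ _ hx hy =>
        intro v hv
        rw [Matrix.add_mulVec]
        exact (M a).add_mem (hx v hv) (hy v hv)
      | mul x y _ _ hx hy =>
        intro v hv
        rw [← Matrix.mulVec_mulVec]
        exact hx _ (hy v hv)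
    rw [LinearMap.mem_ker, Matrix.toLin'_apply]
    by_contra hne
    let ev : Matrix n n ℂ →ₗ[ℂ] (n → ℂ) :=
      { toFun := fun y => y.mulVec (F.mulVec v)
        map_add' := fun _ _ => Matrix.add_mulVec _ _ _
        map_smul' := fun _ _ => Matrix.smul_mulVec _ _ _ }
    -- The orbit of $Fv\ne0$ under the algebra is an invariant subspace of the block, hence all of
    -- it, so some $x$ satisfies $xFv=v$.
    have horb := hmin (B.toSubmodule.map ev) (by
      rintro _ ⟨y, hy, rfl⟩
      exact hinvB y hy _ (hinvB F hF v hv)) (by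
      rintro S hS _ ⟨y, hy, rfl⟩
      exact ⟨S * y, B.mul_mem (Algebra.subset_adjoin hS) hy, (Matrix.mulVec_mulVec _ _ _).symm⟩)
    have hmem : F.mulVec v ∈ B.toSubmodule.map ev :=
      ⟨1, B.one_mem, Matrix.one_mulVec _⟩
    obtain ⟨x, hx, hxv⟩ : v ∈ B.toSubmodule.map ev := by
      rcases horb with h | h
      · rw [h, Submodule.mem_bot] at hmem
        exact absurd hmem hne
      · rwa [h]
    have hv0 : v ≠ 0 := by
      rintro rfl
      simp at hne
    have hfix : Matrix.toLin' (x * F) v = v := by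
      rw [Matrix.toLin'_apply, ← Matrix.mulVec_mulVec]
      exact hxv
    obtain ⟨r, hr⟩ := exists_trace_pow_ne_zero _ hv0 hfix
    apply hr
    rw [← Matrix.toLin'_pow, Matrix.trace_toLin'_eq]
    -- Exponent at least two exposes two factors `F`, as `htr` requires.
    have : (x * F) ^ (r + 2) = x * (F * ((x * F) ^ r * x * F)) := by
      rw [pow_succ, pow_succ']
      simp only [mul_assoc]
    rw [this, Matrix.trace_mul_comm, mul_assoc]
    exact htr _ (B.mul_mem (B.pow_mem (B.mul_mem hx hF) r) hx) _ hx
  have htop : LinearMap.ker (Matrix.toLin' F) = ⊤ :=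
    top_le_iff.1 (hM.submodule_iSup_eq_top ▸ iSup_le hker)
  exact (LinearEquiv.map_eq_zero_iff _).1 (LinearMap.ker_eq_top.1 htop)

/-! ### Words in the doubled tensor and their traces. -/

/-- The product of doubled tensors along a list of pairs of physical indices. -/
def word {p : Type} [Fintype p] {D : ℕ} (A : Tensor p D) (L : List (p × p)) :
    Matrix (Fin D × Fin D) (Fin D × Fin D) ℂ :=
  (L.map fun x => double A x.1 x.2).prod

theorem word_append {p : Type} [Fintype p] {D : ℕ} (A : Tensor p D) (K L : List (p × p)) :
    word A (K ++ L) = word A K * word A L := by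
  simp [word]

theorem word_singleton {p : Type} [Fintype p] {D : ℕ} (A : Tensor p D) (i k : p) :
    word A [(i, k)] = double A i k := by
  simp [word]

theorem chain_succ {p : Type} {D : ℕ} (A : Tensor p D) {N : ℕ} (i j : Fin (N + 1) → p) :
    chain A i j = A (i 0) (j 0) * chain A (Fin.tail i) (Fin.tail j) := by
  simp [chain, List.ofFn_succ, Fin.tail]

theorem word_ofFn {p : Type} [Fintype p] {D : ℕ} (A : Tensor p D) {N : ℕ}
    (i j : Fin N → p) :
    word A (List.ofFn fun k => (i k, j k)) =
      ∑ l : Fin N → p, (chain A l i).map (starRingEnd ℂ) ⊗ₖ chain A l j := by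
  induction N with
  | zero => simp [word, chain]
  | succ N ih =>
    have h := ih (Fin.tail i) (Fin.tail j)
    rw [List.ofFn_succ, ← List.singleton_append, word_append, word_singleton]
    simp only [Fin.tail] at h
    rw [h, ← (Fin.consEquiv fun _ => p).sum_comp, Fintype.sum_prod_type, double,
      Finset.sum_mul_sum]
    refine Finset.sum_congr rfl fun a _ => Finset.sum_congr rfl fun l _ => ?_
    rw [← Matrix.mul_kronecker_mul, chain_succ, chain_succ A _ j, Matrix.map_mul]
    simp [Fin.consEquiv, Fin.tail_def]

open Classical in
theorem trace_word {p : Type} [Fintype p] [DecidableEq p] {D : ℕ} {A : Tensor p D}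
    {U : OperatorFamily p} (hU : IsUnitaryFamily U) (hA : Represents A 1 U)
    {L : List (p × p)} (hL : 1 < L.length) :
    (word A L).trace = if ∀ x ∈ L, x.1 = x.2 then 1 else 0 := by
  obtain ⟨N, f, rfl⟩ : ∃ (N : ℕ) (f : Fin N → p × p), L = List.ofFn f :=
    ⟨_, L.get, (List.ofFn_get L).symm⟩
  rw [List.length_ofFn] at hL
  have h := congrFun (congrFun (Matrix.mem_unitaryGroup_iff'.1 (hU N hL)) fun k => (f k).1)
    fun k => (f k).2
  rw [Matrix.mul_apply, Matrix.one_apply] at h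
  have e : (List.ofFn f) = List.ofFn fun k => ((f k).1, (f k).2) := rfl
  have hdiag : (∀ x ∈ List.ofFn f, x.1 = x.2) ↔ (fun k => (f k).1) = fun k => (f k).2 := by
    rw [List.forall_mem_ofFn_iff, funext_iff]
  simp only [hdiag]
  rw [e, word_ofFn, Matrix.trace_sum]
  simp only [Matrix.trace_kronecker]
  refine Eq.trans (Finset.sum_congr rfl fun l _ => ?_) (h.trans (by congr))
  rw [hA N hL, Matrix.star_apply]
  simp only [mpo, Matrix.of_apply, one_mul]
  congr 1
  simp [Matrix.trace]

/-- Reduces trace conditions over the algebra to words; the empty word accounts for the unit. -/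
theorem mem_span_word {p : Type} [Fintype p] {D : ℕ} (A : Tensor p D)
    {x : Matrix (Fin D × Fin D) (Fin D × Fin D) ℂ}
    (hx : x ∈ Algebra.adjoin ℂ (opSpan A : Set (Matrix (Fin D × Fin D) (Fin D × Fin D) ℂ))) :
    x ∈ Submodule.span ℂ (Set.range (word A)) := by
  rw [opSpan, Algebra.adjoin_span, ← Subalgebra.mem_toSubmodule, Algebra.adjoin_eq_span] at hx
  refine Submodule.span_mono ?_ hx
  intro y hy
  obtain ⟨l, hl, rfl⟩ := Submonoid.exists_list_of_mem_closure hy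
  have : l ∈ Set.range (List.map fun x : p × p => double A x.1 x.2) := by
    rw [Set.range_list_map]
    exact hl
  obtain ⟨L, rfl⟩ := this
  exact ⟨L, rfl⟩

theorem word_mem_adjoin {p : Type} [Fintype p] {D : ℕ} (A : Tensor p D) (L : List (p × p)) :
    word A L ∈
      Algebra.adjoin ℂ (opSpan A : Set (Matrix (Fin D × Fin D) (Fin D × Fin D) ℂ)) := by
  refine Subalgebra.list_prod_mem _ fun x hx => ?_
  obtain ⟨y, -, rfl⟩ := List.mem_map.1 hx
  exact Algebra.subset_adjoin (Submodule.subset_span ⟨y, rfl⟩)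

/-! ### Collapse of the doubled tensor. -/

open Classical in
/-- A combination of two words of doubled tensors which is traceless in every context vanishes
for a semi-simple tensor. -/
theorem word_eq_smul_word {p : Type} [Fintype p] [DecidableEq p] {D : ℕ} {A : Tensor p D}
    {U : OperatorFamily p} (hU : IsUnitaryFamily U) (hA : Represents A 1 U) (hs : IsSemisimple A)
    {K₁ K₂ : List (p × p)} (h₁ : K₁ ≠ []) (h₂ : K₂ ≠ []) (c : ℂ)
    (hK : (if ∀ x ∈ K₁, x.1 = x.2 then (1 : ℂ) else 0) =
      c * if ∀ x ∈ K₂, x.1 = x.2 then 1 else 0) :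
    word A K₁ = c • word A K₂ := by
  obtain ⟨m, M, hM, hirr⟩ := hs
  rw [← sub_eq_zero]
  have hlen : ∀ K : List (p × p), K ≠ [] → 1 ≤ K.length := fun K h =>
    List.length_pos_iff.2 h
  -- A nonempty context gives total length at least two, where unitarity fixes the trace.
  have hctx : ∀ L : List (p × p), L ≠ [] →
      ((word A K₁ - c • word A K₂) * word A L).trace = 0 := by
    intro L hL
    have e : ∀ K : List (p × p), K ≠ [] → (word A K * word A L).trace =
        (if ∀ x ∈ K, x.1 = x.2 then 1 else 0) * if ∀ x ∈ L, x.1 = x.2 then 1 else 0 := by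
      intro K hK
      have := hlen K hK
      have := hlen L hL
      rw [← word_append, trace_word hU hA (by rw [List.length_append]; omega)]
      simp only [List.forall_mem_append]
      split_ifs <;> first | (exfalso; tauto) | simp
    rw [sub_mul, Matrix.smul_mul, Matrix.trace_sub, Matrix.trace_smul, e _ h₁, e _ h₂, hK,
      smul_eq_mul]
    ring
  refine eq_zero_of_trace_mul_eq_zero hM hirr (Subalgebra.sub_mem _ (word_mem_adjoin A _)
    (Subalgebra.smul_mem _ (word_mem_adjoin A _) _)) fun x hx y hy => ?_
  replace hx := mem_span_word A hx
  induction hx using Submodule.span_induction with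
  | zero => simp
  | add x x' _ _ hx hx' =>
    rw [add_mul, add_mul, mul_add, Matrix.trace_add, hx, hx', add_zero]
  | smul a x _ hx =>
    rw [Matrix.smul_mul, Matrix.smul_mul, Matrix.mul_smul, Matrix.trace_smul, hx, smul_zero]
  | mem x hx =>
    obtain ⟨L, rfl⟩ := hx
    replace hy := mem_span_word A hy
    induction hy using Submodule.span_induction with
    | zero => simp
    | add y y' _ _ hy hy' =>
      rw [mul_add, mul_add, Matrix.trace_add, hy, hy', add_zero]
    | smul a y _ hy =>
      rw [Matrix.mul_smul, Matrix.mul_smul, Matrix.trace_smul, hy, smul_zero]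
    | mem y hy =>
      obtain ⟨L', rfl⟩ := hy
      -- `L` and `L'` may be empty, but the second copy of the difference still supplies nonempty
      -- contexts for the first.
      have : word A L * (word A K₁ - c • word A K₂) * word A L' =
          word A (L ++ K₁ ++ L') - c • word A (L ++ K₂ ++ L') := by
        simp only [word_append, mul_sub, sub_mul, Matrix.mul_smul, Matrix.smul_mul]
      rw [this, mul_sub, Matrix.mul_smul, Matrix.trace_sub, Matrix.trace_smul,
        hctx (L ++ K₁ ++ L') (by simp [h₁]),
        hctx (L ++ K₂ ++ L') (by simp [h₂]), smul_zero, sub_zero]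

/-- The doubled tensor of a semi-simple periodic unitary is the identity tensored with an
idempotent of trace one. -/
theorem exists_double_eq {p : Type} [Fintype p] [DecidableEq p] [Nonempty p] {D : ℕ}
    {A : Tensor p D} {U : OperatorFamily p} (hU : IsUnitaryFamily U) (hA : Represents A 1 U)
    (hs : IsSemisimple A) :
    ∃ E : Matrix (Fin D × Fin D) (Fin D × Fin D) ℂ, E * E = E ∧ E.trace = 1 ∧
      ∀ i k, double A i k = if i = k then E else 0 := by
  classical
  obtain ⟨o⟩ := ‹Nonempty p›
  have hidem : double A o o * double A o o = double A o o := by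
    have h := word_eq_smul_word hU hA hs (K₁ := [(o, o), (o, o)]) (K₂ := [(o, o)])
      (by simp) (by simp) 1 (by simp)
    simpa [word] using h
  refine ⟨double A o o, hidem, ?_, fun i k => ?_⟩
  -- Unitarity says nothing about words of length one, so the trace of $E$ is read off from $E^2$.
  · have h := trace_word hU hA (L := [(o, o), (o, o)]) (by simp)
    simpa [word, hidem] using h
  · split_ifs with hik
    · have h := word_eq_smul_word hU hA hs (K₁ := [(i, k)]) (K₂ := [(o, o)])
        (by simp) (by simp) 1 (by simp [hik])
      simpa [word] using h
    · have h := word_eq_smul_word hU hA hs (K₁ := [(i, k)]) (K₂ := [(o, o)])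
        (by simp) (by simp) 0 (by simp [hik])
      simpa [word] using h

/-! ### Splitting the tensor into a physical and a bond factor. -/

theorem double_apply {p : Type} [Fintype p] {D : ℕ} (A : Tensor p D) (i k : p)
    (a b c e : Fin D) :
    double A i k (a, c) (b, e) = ∑ l, starRingEnd ℂ (A l i a b) * A l k c e := by
  simp [double, Matrix.sum_apply]

/-- The tensor of a semi-simple periodic unitary is a unitary times a fixed bond matrix. -/
theorem exists_tensor_eq_smul {p : Type} [Fintype p] [DecidableEq p] [Nonempty p] {D : ℕ}
    {A : Tensor p D} {E : Matrix (Fin D × Fin D) (Fin D × Fin D) ℂ} (hE : E ≠ 0)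
    (h : ∀ i k, double A i k = if i = k then E else 0) :
    ∃ V ∈ Matrix.unitaryGroup p ℂ, ∃ w : Matrix (Fin D) (Fin D) ℂ,
      (∀ l k, A l k = V l k • w) ∧ w.map (starRingEnd ℂ) ⊗ₖ w = E := by
  obtain ⟨o⟩ := ‹Nonempty p›
  have hsum : ∀ i k a b c e, ∑ l, starRingEnd ℂ (A l i a b) * A l k c e =
      if i = k then E (a, c) (b, e) else 0 := by
    intro i k a b c e
    rw [← double_apply, h]
    split_ifs <;> rfl
  obtain ⟨l, a, b, hab⟩ : ∃ l a b, A l o a b ≠ 0 := by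
    by_contra! h0
    apply hE
    ext ⟨a, c⟩ ⟨b, e⟩
    have := hsum o o a b c e
    rw [if_pos rfl] at this
    simp [← this, h0]
  -- At the fixed bond entry $(a,b)$ the columns of the physical matrix are orthogonal with common
  -- squared norm `s`; dividing by $\sqrt s$ gives the unitary `V`.
  set s : ℝ := ∑ l, ‖A l o a b‖ ^ 2 with hs
  have hs0 : 0 < s :=
    Finset.sum_pos' (fun _ _ => by positivity) ⟨l, Finset.mem_univ _, by positivity⟩
  have hEs : E (a, a) (b, b) = s := by
    have := hsum o o a b a b
    rw [if_pos rfl] at this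
    rw [← this, hs]
    push_cast
    exact Finset.sum_congr rfl fun l _ => Complex.conj_mul' _
  set r : ℂ := ((Real.sqrt s : ℝ) : ℂ) with hr
  have hr0 : r ≠ 0 := Complex.ofReal_ne_zero.2 (Real.sqrt_pos.2 hs0).ne'
  have hrr : r * r = s := by
    rw [hr, ← Complex.ofReal_mul, Real.mul_self_sqrt hs0.le]
  have hrc : starRingEnd ℂ r = r := Complex.conj_ofReal _
  let V : Matrix p p ℂ := Matrix.of fun l k => A l k a b / r
  have hcol : ∀ c e, star V * Matrix.of (fun l k => A l k c e) =
      (E (a, c) (b, e) / r) • (1 : Matrix p p ℂ) := by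
    intro c e
    ext i k
    rw [Matrix.mul_apply]
    calc _ = (∑ l, starRingEnd ℂ (A l i a b) * A l k c e) / r := by
          rw [Finset.sum_div]
          refine Finset.sum_congr rfl fun l _ => ?_
          simp only [V, Matrix.star_apply, Matrix.of_apply, RCLike.star_def, map_div₀, hrc]
          ring
      _ = _ := by
          rw [hsum, Matrix.smul_apply, Matrix.one_apply]
          split_ifs <;> simp
  have hV : V ∈ Matrix.unitaryGroup p ℂ := by
    rw [Matrix.mem_unitaryGroup_iff']
    have hVr : V = r⁻¹ • Matrix.of (fun l k => A l k a b) := by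
      ext l k
      simp [V, div_eq_inv_mul]
    conv_lhs => rw [hVr]
    rw [← hVr, hVr, Matrix.mul_smul, ← hVr, hcol, hEs, ← hrr, smul_smul]
    field_simp
    simp
  obtain ⟨w, htensor⟩ : ∃ w : Matrix (Fin D) (Fin D) ℂ, ∀ l k, A l k = V l k • w := by
    refine ⟨Matrix.of fun c e => E (a, c) (b, e) / r, fun l k => ?_⟩
    ext c e
    -- Every bond entry has scalar overlap with `V`; multiplying by `V` makes it a multiple of `V`.
    have h1 := congrArg (V * ·) (hcol c e)
    simp only [← mul_assoc, Matrix.mem_unitaryGroup_iff.1 hV, one_mul, Matrix.mul_smul,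
      mul_one] at h1
    have h2 := congrFun (congrFun h1 l) k
    simp only [Matrix.of_apply, Matrix.smul_apply, smul_eq_mul] at h2 ⊢
    rw [h2, mul_comm]
  refine ⟨V, hV, w, htensor, ?_⟩
  have hd := h o o
  rw [if_pos rfl] at hd
  rw [← hd, double]
  have hone := congrFun (congrFun (Matrix.mem_unitaryGroup_iff'.1 hV) o) o
  rw [Matrix.mul_apply, Matrix.one_apply_eq] at hone
  ext ⟨x, y⟩ ⟨z, t⟩
  simp only [Matrix.sum_apply, Matrix.kroneckerMap_apply, Matrix.map_apply, htensor,
    Matrix.smul_apply, smul_eq_mul, map_mul]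
  calc _ = (∑ l, star V o l * V l o) * (starRingEnd ℂ (w x z) * w y t) := by
        rw [hone, one_mul]
    _ = _ := by
        rw [Finset.sum_mul]
        refine Finset.sum_congr rfl fun l _ => ?_
        rw [Matrix.star_apply, RCLike.star_def]
        ring

/-! ### Traces of powers of the bond matrix. -/

/-- If `conj w ⊗ w` is idempotent of trace one, then `Tr (w ^ N) = μ ^ N` for a phase `μ`. -/
theorem exists_trace_pow_eq {D : ℕ} {w : Matrix (Fin D) (Fin D) ℂ}
    (hw : (w.map (starRingEnd ℂ) ⊗ₖ w) * (w.map (starRingEnd ℂ) ⊗ₖ w) =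
      w.map (starRingEnd ℂ) ⊗ₖ w)
    (htr : (w.map (starRingEnd ℂ) ⊗ₖ w).trace = 1) :
    ∃ θ : ℝ, ∀ N : ℕ, 1 ≤ N → (w ^ N).trace = Complex.exp (Complex.I * θ) ^ N := by
  set t := w.trace with ht
  have htt : starRingEnd ℂ t * t = 1 := by
    rw [Matrix.trace_kronecker] at htr
    rw [← htr, ht]
    congr 1
    simp [Matrix.trace]
  have ht0 : t ≠ 0 := right_ne_zero_of_mul_eq_one htt
  obtain ⟨a, b, hab⟩ : ∃ a b, w a b ≠ 0 := by
    by_contra! h0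
    apply ht0
    simp [ht, Matrix.trace, h0]
  rw [← Matrix.mul_kronecker_mul, ← Matrix.map_mul] at hw
  -- Comparing $\overline{w^2}\otimes w^2=\bar w\otimes w$ at a nonzero entry of the first factor
  -- gives $\kappa w^2=w$.
  set κ := starRingEnd ℂ ((w * w) a b) / starRingEnd ℂ (w a b) with hκ
  have hab' : starRingEnd ℂ (w a b) ≠ 0 := (map_ne_zero _).2 hab
  have hκw : κ • (w * w) = w := by
    ext c e
    have h := congrFun (congrFun hw (a, c)) (b, e)
    simp only [Matrix.kroneckerMap_apply, Matrix.map_apply] at h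
    rw [Matrix.smul_apply, smul_eq_mul, hκ, div_mul_eq_mul_div, h, mul_div_cancel_left₀ _ hab']
  have hκ0 : κ ≠ 0 := by
    intro h0
    rw [h0, zero_smul] at hκw
    simp [← hκw] at hab
  have hsq : κ * (w * w).trace = t := by
    rw [ht]
    conv_rhs => rw [← hκw]
    rw [Matrix.trace_smul, smul_eq_mul]
  have hnt : ‖t‖ = 1 := by
    have h := congrArg norm htt
    rw [norm_mul, RCLike.norm_conj, norm_one] at h
    nlinarith [norm_nonneg t]
  have hnκ : ‖κ‖ = 1 := by
    have h := congrArg norm (congrArg Matrix.trace hw)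
    rw [htr, Matrix.trace_kronecker, norm_one, norm_mul] at h
    have e : ((w * w).map (starRingEnd ℂ)).trace = starRingEnd ℂ (w * w).trace := by
      rw [Matrix.trace, Matrix.trace, map_sum]
      rfl
    rw [e, RCLike.norm_conj] at h
    have h1 : ‖(w * w).trace‖ = 1 := by nlinarith [norm_nonneg (w * w).trace]
    have h2 := congrArg norm hsq
    rwa [norm_mul, h1, mul_one, hnt] at h2
  have hid : IsIdempotentElem (Matrix.toLin' (κ • w)) := by
    rw [IsIdempotentElem, Module.End.mul_eq_comp, ← Matrix.toLin'_mul, Matrix.smul_mul,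
      Matrix.mul_smul, hκw]
  -- The trace of the idempotent $\kappa w$ is its rank, a natural number of modulus
  -- $|\kappa||t|=1$.
  have hκt : κ * t = 1 := by
    have h := (LinearMap.IsIdempotentElem.isProj_range _ hid).trace
    rw [Matrix.trace_toLin'_eq, Matrix.trace_smul, smul_eq_mul, ← ht] at h
    have hn := congrArg norm h
    rw [norm_mul, hnκ, hnt, one_mul, Complex.norm_natCast] at hn
    rw [h]
    exact_mod_cast hn.symm
  have hpow : ∀ N : ℕ, (w ^ (N + 1)).trace = t ^ (N + 1) := by
    intro N
    have : κ ^ N • w ^ (N + 1) = w := by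
      induction N with
      | zero => simp
      | succ N ih =>
        calc κ ^ (N + 1) • w ^ (N + 1 + 1) = κ • ((κ ^ N • w ^ (N + 1)) * w) := by
              rw [Matrix.smul_mul, smul_smul, ← pow_succ', ← pow_succ]
          _ = w := by rw [ih, hκw]
    have h := congrArg Matrix.trace this
    rw [Matrix.trace_smul, smul_eq_mul, ← ht] at h
    apply mul_left_cancel₀ (pow_ne_zero N hκ0)
    rw [h, pow_succ, ← mul_assoc, ← mul_pow, hκt, one_pow, one_mul]
  refine ⟨Complex.arg t, fun N hN => ?_⟩
  have hexp : Complex.exp (Complex.I * Complex.arg t) = t := by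
    have h := Complex.norm_mul_exp_arg_mul_I t
    rwa [hnt, Complex.ofReal_one, one_mul, mul_comm] at h
  obtain ⟨n, rfl⟩ := Nat.exists_eq_add_of_le' hN
  rw [hexp, hpow]

/-! ### Product operators and blocking. -/

theorem chain_smul {p : Type} {D : ℕ} {A : Tensor p D} {V : Matrix p p ℂ}
    {w : Matrix (Fin D) (Fin D) ℂ} (h : ∀ l k, A l k = V l k • w) {N : ℕ} (i j : Fin N → p) :
    chain A i j = (∏ k, V (i k) (j k)) • w ^ N := by
  induction N with
  | zero => simp [chain]
  | succ N ih =>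
    rw [chain_succ, ih, h, Fin.prod_univ_succ, pow_succ', Matrix.smul_mul, Matrix.mul_smul,
      smul_smul]
    rfl

theorem tensorPower_mem_unitaryGroup {p : Type} [Fintype p] [DecidableEq p] {V : Matrix p p ℂ}
    (hV : V ∈ Matrix.unitaryGroup p ℂ) (N : ℕ) :
    tensorPower V N ∈ Matrix.unitaryGroup (Fin N → p) ℂ := by
  rw [Matrix.mem_unitaryGroup_iff'] at hV ⊢
  ext i j
  have h : ∀ k, ∑ l, starRingEnd ℂ (V l (i k)) * V l (j k) = if i k = j k then 1 else 0 :=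
    fun k => congrFun (congrFun hV (i k)) (j k)
  rw [Matrix.mul_apply, Matrix.one_apply]
  simp only [tensorPower, Matrix.star_apply, Matrix.of_apply, RCLike.star_def, map_prod,
    ← Finset.prod_mul_distrib]
  rw [← Fintype.prod_sum fun k l => starRingEnd ℂ (V l (i k)) * V l (j k)]
  simp only [h, Finset.prod_ite_zero, funext_iff]
  simp

theorem block_tensorPower {p : Type} (V : Matrix p p ℂ) (q : ℕ) :
    OperatorFamily.block q (tensorPower V) = tensorPower (tensorPower V q) := by
  funext N
  ext i j
  simp only [OperatorFamily.block, tensorPower, Matrix.of_apply, unblock]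
  exact (finProdFinEquiv.symm.prod_comp
    fun x : Fin N × Fin q => V (i x.1 x.2) (j x.1 x.2)).trans (Fintype.prod_prod_type _)

/-- Blocking two sites is needed only because the tensor does not determine $U_1$: every blocked
ring has at least two original sites. -/
theorem exists_isProductUnitary_block {p : Type} [Fintype p] [DecidableEq p]
    {U : OperatorFamily p} (h : IsPeriodicSemisimpleMPU U) :
    IsProductUnitary (OperatorFamily.block 2 U) := by
  obtain ⟨hU, D, A, hA, hs⟩ := h
  rcases isEmpty_or_nonempty p with hp | hp
  · refine ⟨0, 1, one_mem _, fun N hN => ?_⟩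
    ext i
    exact isEmptyElim (i ⟨0, hN⟩ 0)
  obtain ⟨E, hidem, htr, hE⟩ := exists_double_eq hU hA hs
  obtain ⟨V, hV, w, hAw, hw⟩ := exists_tensor_eq_smul (by rintro rfl; simp at htr) hE
  subst hw
  obtain ⟨θ, hθ⟩ := exists_trace_pow_eq hidem htr
  refine ⟨2 * θ, tensorPower V 2, tensorPower_mem_unitaryGroup hV 2, fun N hN => ?_⟩
  rw [← block_tensorPower]
  ext i j
  simp only [OperatorFamily.block, Matrix.of_apply, Matrix.smul_apply, smul_eq_mul]
  rw [hA _ (by omega), mpo, Matrix.of_apply, one_mul, chain_smul hAw, Matrix.trace_smul,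
    hθ _ (by omega), smul_eq_mul, mul_comm, ← Complex.exp_nat_mul]
  simp only [tensorPower, Matrix.of_apply]
  congr 2
  push_cast
  ring

end MPU

theorem mainTheorem3 :
    (∀ (d : ℕ) (U : MPU.OperatorFamily (Fin d)), MPU.IsPeriodicSemisimpleMPU U →
      ∃ q : ℕ, 1 ≤ q ∧ MPU.IsProductUnitary (MPU.OperatorFamily.block q U)) ∧
    (∀ (d : ℕ) (U : MPU.OperatorFamily (Fin d)), MPU.IsQCA U →
      (¬ ∃ q : ℕ, 1 ≤ q ∧ MPU.IsProductUnitary (MPU.OperatorFamily.block q U)) →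
      ¬ MPU.IsPeriodicSemisimpleMPU U) := by
  have main : ∀ (d : ℕ) (U : MPU.OperatorFamily (Fin d)), MPU.IsPeriodicSemisimpleMPU U →
      ∃ q : ℕ, 1 ≤ q ∧ MPU.IsProductUnitary (MPU.OperatorFamily.block q U) :=
    fun _ _ h => ⟨2, one_le_two, MPU.exists_isProductUnitary_block h⟩
  exact ⟨main, fun d U _ hn h => hn (main d U h)⟩
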